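/- Let $\mathbb{k}$ be a commutative unital ring, $A$ an associative unital $\mathbb{k}$-algebra, and $\Omega_d^\bullet$ an exterior algebra over $A$: a graded associative $\mathbb{k}$-algebra with $\Omega_d^0=A$, product $\wedge$, and a $\mathbb{k}$-linear differential $d$ of degree $1$ with $d^2=0$ and the graded Leibniz rule, generated as an algebra by $A$ and $dA$. For a left $A$-module $E$, let $J_d^1E=J_d^1A\otimes_A E$, where $J^1_dA$ is the quotient of $A\otimes A$ by the kernel of $\sum a_i\otimes b_i\mapsto(\sum a_ib_i,\sum (da_i)b_i)\in A\times\Omega^1_d$, with prolongation $j^1_d(e)=[1\otimes 1]\otimes e$. The holonomic jet modules are $J_d^0E=E$ (with $j_d^0=\mathrm{id}_E$), $J_d^1E$, and, for $n\ge 2$, the submodule $J_d^nE\subseteq J_d^1J_d^{n-1}E$ of the elements that $J_d^1(l^{n-1})$ sends into the joint kernel of the maps $[a\otimes b]\otimes[c\otimes e]\mapsto a\,d(bc)\otimes e\in\Omega_d^1\otimes_AJ_d^{n-2}E$ and $[a\otimes b]\otimes[c\otimes e]\mapsto da\wedge d(bc)\otimes e\in\Omega_d^2\otimes_AJ_d^{n-2}E$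 on $J^1_dJ^1_dJ_d^{n-2}E$. Here $l^{n-1}\colon J_d^{n-1}E\to J_d^1J_d^{n-2}E$ is the inclusion (the identity for $n=2$); $j_d^n\colon E\to J_d^nE$ is $j_d^1\circ j_d^{n-1}$. For left $A$-modules $E,F$ let $\mathrm{Diff}_d^n(E,F)$ be the set of $\mathbb{k}$-linear maps $\Delta\colon E\to F$ such that $\Delta=\widetilde\Delta\circ j_d^n$ for some $A$-linear $\widetilde\Delta\colon J_d^nE\to F$. Put $\mathrm{Diff}_d^{-1}(E,F)=0$, $\mathrm{Diff}_d(E,F)=\bigcup_n\mathrm{Diff}_d^n(E,F)$, $\mathrm{Symb}_d^n(E,F)=\mathrm{Diff}_d^n(E,F)/\mathrm{Diff}_d^{n-1}(E,F)$ with quotient map $\varsigma_d^n$, and $\mathrm{Symb}_d^\bullet(E,F)=\bigoplus_{n\in\mathbb{N}}\mathrm{Symb}_d^n(E,F)$. The ring ${}_A\mathrm{Hom}(F,F)$ acts on all of these by composition. A full quantization for $(E,F)$ is a map $q=\sum_nq^n\colon\mathrm{Symb}_d^\bullet(E,F)\to\mathrm{Diff}_d(E,F)$ where each $q^n\colon\mathrm{Symb}_d^n(E,F)\to\mathrm{Diff}_d^n(E,F)$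 is ${}_A\mathrm{Hom}(F,F)$-linear and $\varsigma_d^n\circ q^n=\mathrm{id}$. A natural full quantization for $E$ is a map $q=\sum_nq^n$ where each $q^n\colon\mathrm{Symb}_d^n(E,-)\to\mathrm{Diff}_d^n(E,-)$ is a natural transformation of functors from left $A$-modules to $\mathbb{k}$-modules with $\varsigma_d^n\circ q^n=\mathrm{id}$; its component at each $F$ is a full quantization for $(E,F)$. Given a full quantization $q$ for $(E,F)$ and $\Delta\in\mathrm{Diff}_d(E,F)$ of order $n$, the truncations of $\Delta$ are $\Delta_k:=\Delta$ for $k\ge n$ and, recursively, $\Delta_k:=\Delta_{k+1}-q^{k+1}(\varsigma_d^{k+1}(\Delta_{k+1}))\in\mathrm{Diff}_d^k(E,F)$ for $0\le k<n$. Put $[\Delta]_q^k:=\varsigma_d^k(\Delta_k)$; it vanishes for $k>n$. The total symbol of $\Delta$ is $\varsigma_q(\Delta):=\sum_{k\in\mathbb{N}}[\Delta]_q^k\in\mathrm{Symb}_d^\bullet(E,F)$. **Proposition 5.24.** Let $E$ be a left $A$-module. 1. For every left $A$-module $F$, every full quantization $q$ for $(E,F)$ is invertible with inverse $\varsigma_q$,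 and this gives an ${}_A\mathrm{Hom}(F,F)$-linear isomorphism $\mathrm{Diff}_d(E,F)\cong\mathrm{Symb}_d^\bullet(E,F)$. Moreover, every $\Delta\in\mathrm{Diff}_d(E,F)$ is the sum of its homogeneous components: $\Delta=\sum_{k\in\mathbb{N}}q^k([\Delta]_q^k)$, where only finitely many terms are nonzero. 2. Every natural full quantization $q$ for $E$ is a natural isomorphism $\mathrm{Symb}_d^\bullet(E,-)\cong\mathrm{Diff}_d(E,-)$ of functors from left $A$-modules to $\mathbb{k}$-modules, whose inverse has the component $\varsigma_{q_F}$ at each $F$. -/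

import Mathlib

open scoped TensorProduct DirectSum
open CategoryTheory

universe u w

noncomputable section

namespace NCJet

/-! ### Exterior algebras over a noncommutative algebra -/

/-- An exterior algebra `Ω_d^•` over an associative unital `k`-algebra `A`: a graded associative
`k`-algebra with `Ω^0 = A`, a `k`-linear differential `d` of degree one with `d ∘ d = 0` that
satisfies the graded Leibniz rule, such that `Ω` is generated as an algebra by `A` and `dA`.
The product of `Ω` is the wedge product. -/
structure ExteriorCalculus (k : Type w) [CommRing k] (A : Type u) [Ring A] [Algebra k A] where
  /-- the total space of forms -/
  Ω : Type u
  [ring : Ring Ω]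
  [algebra : Algebra k Ω]
  /-- the homogeneous components -/
  deg : ℕ → Submodule k Ω
  [graded : GradedAlgebra deg]
  /-- the identification of `A` with the forms of degree zero -/
  ι : A →ₐ[k] Ω
  ι_injective : Function.Injective ι
  range_ι : LinearMap.range ι.toLinearMap = deg 0
  /-- the exterior derivative -/
  d : Ω →ₗ[k] Ω
  d_mem : ∀ (n : ℕ) (ω : Ω), ω ∈ deg n → d ω ∈ deg (n + 1)
  d_d : ∀ ω : Ω, d (d ω) = 0
  leibniz : ∀ (n : ℕ) (ω η : Ω), ω ∈ deg n → d (ω * η) = d ω * η + (-1) ^ n * (ω * d η)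
  generated : Algebra.adjoin k (Set.range ι ∪ Set.range (fun a => d (ι a))) = ⊤

attribute [instance] ExteriorCalculus.ring ExteriorCalculus.algebra ExteriorCalculus.graded

variable {k : Type w} [CommRing k] {A : Type u} [Ring A] [Algebra k A]
variable (X : ExteriorCalculus k A)

namespace ExteriorCalculus

/-- The `A`-bimodule `Ω_d^m` of forms of degree `m`. -/
def Form (m : ℕ) : Type u := X.deg m

instance (m : ℕ) : AddCommGroup (X.Form m) := inferInstanceAs (AddCommGroup (X.deg m))

variable {X}

lemma ι_mem (a : A) : X.ι a ∈ X.deg 0 := by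
  rw [← X.range_ι]
  exact ⟨a, rfl⟩

lemma mul_mem' {m n l : ℕ} (h : m + n = l) {ω η : X.Ω} (hω : ω ∈ X.deg m) (hη : η ∈ X.deg n) :
    ω * η ∈ X.deg l := h ▸ SetLike.mul_mem_graded hω hη

/-- The wedge product of homogeneous forms. -/
def Form.wedge {m n l : ℕ} (h : m + n = l) (ω : X.Form m) (η : X.Form n) : X.Form l :=
  ⟨ω.1 * η.1, mul_mem' h ω.2 η.2⟩

/-- The exterior derivative on forms of degree `m`. -/
def Form.diff {m : ℕ} (ω : X.Form m) : X.Form (m + 1) := ⟨X.d ω.1, X.d_mem m _ ω.2⟩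

/-- An element of `A` as a form of degree zero. -/
def Form.ofAlg (X : ExteriorCalculus k A) (a : A) : X.Form 0 := ⟨X.ι a, ι_mem a⟩

/-- The differential `da` of `a : A`. -/
def dA (X : ExteriorCalculus k A) (a : A) : X.Form 1 := (Form.ofAlg X a).diff

/-- The left action of `A` on forms is left multiplication. -/
instance (m : ℕ) : Module A (X.Form m) where
  smul a ω := (Form.ofAlg X a).wedge (zero_add m) ω
  one_smul ω := Subtype.ext (by change X.ι 1 * ω.1 = ω.1; simp)
  mul_smul a b ω := Subtype.ext (by
    change X.ι (a * b) * ω.1 = X.ι a * (X.ι b * ω.1); simp [mul_assoc])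
  smul_zero a := Subtype.ext (by change X.ι a * 0 = 0; simp)
  smul_add a ω η := Subtype.ext (by
    change X.ι a * (ω.1 + η.1) = X.ι a * ω.1 + X.ι a * η.1; exact mul_add _ _ _)
  add_smul a b ω := Subtype.ext (by
    change X.ι (a + b) * ω.1 = X.ι a * ω.1 + X.ι b * ω.1; simp [add_mul])
  zero_smul ω := Subtype.ext (by change X.ι 0 * ω.1 = 0; simp)

/-- The right action of `A` on forms. -/
def Form.rmul {m : ℕ} (ω : X.Form m) (a : A) : X.Form m :=
  ω.wedge (add_zero m) (Form.ofAlg X a)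

@[ext] lemma Form.ext {m : ℕ} {ω η : X.Form m} (h : ω.1 = η.1) : ω = η := Subtype.ext h

@[simp] lemma Form.val_add {m : ℕ} (ω η : X.Form m) : (ω + η).1 = ω.1 + η.1 := rfl
@[simp] lemma Form.val_neg {m : ℕ} (ω : X.Form m) : (-ω).1 = -ω.1 := rfl
@[simp] lemma Form.val_sub {m : ℕ} (ω η : X.Form m) : (ω - η).1 = ω.1 - η.1 := rfl
@[simp] lemma Form.val_zero {m : ℕ} : (0 : X.Form m).1 = 0 := rfl
@[simp] lemma Form.val_smul {m : ℕ} (a : A) (ω : X.Form m) : (a • ω).1 = X.ι a * ω.1 := rfl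
@[simp] lemma Form.val_rmul {m : ℕ} (ω : X.Form m) (a : A) : (ω.rmul a).1 = ω.1 * X.ι a := rfl
@[simp] lemma Form.val_wedge {m n l : ℕ} (h : m + n = l) (ω : X.Form m) (η : X.Form n) :
    (ω.wedge h η).1 = ω.1 * η.1 := rfl
@[simp] lemma Form.val_diff {m : ℕ} (ω : X.Form m) : (ω.diff).1 = X.d ω.1 := rfl
@[simp] lemma val_dA (a : A) : (X.dA a).1 = X.d (X.ι a) := rfl

lemma d_ι_mul (a : A) (ω : X.Ω) : X.d (X.ι a * ω) = X.d (X.ι a) * ω + X.ι a * X.d ω := by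
  simpa using X.leibniz 0 (X.ι a) ω (ι_mem a)

lemma d_mul_ι (ω : X.Form 1) (a : A) :
    X.d (ω.1 * X.ι a) = X.d ω.1 * X.ι a - ω.1 * X.d (X.ι a) := by
  rw [X.leibniz 1 ω.1 (X.ι a) ω.2]
  simp [sub_eq_add_neg]

lemma dA_one : X.dA 1 = 0 := by
  have h := d_ι_mul (X := X) 1 1
  ext
  simpa using h

lemma dA_mul (a b : A) : X.dA (a * b) = (X.dA a).rmul b + a • X.dA b := by
  ext
  simp [d_ι_mul]

lemma dA_add (a b : A) : X.dA (a + b) = X.dA a + X.dA b := by ext; simp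

lemma dA_zero : X.dA 0 = 0 := by ext; simp

end ExteriorCalculus

open ExteriorCalculus

/-! ### The balanced tensor product `Ω_d^m ⊗_A P` -/

section Tens

variable (m : ℕ) (P : Type u) [AddCommGroup P] [Module A P]

/-- The relations `ωa ⊗ p = ω ⊗ ap` that turn the tensor product over `ℤ` into the one over `A`. -/
def tensRel : Submodule A (X.Form m ⊗[ℤ] P) :=
  Submodule.span A {t | ∃ (ω : X.Form m) (a : A) (p : P), t = ω.rmul a ⊗ₜ[ℤ] p - ω ⊗ₜ[ℤ] (a • p)}

/-- The left `A`-module `Ω_d^m ⊗_A P`, for a left `A`-module `P`. -/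
def Tens : Type u := (X.Form m ⊗[ℤ] P) ⧸ tensRel X m P

instance : AddCommGroup (Tens X m P) :=
  inferInstanceAs (AddCommGroup ((X.Form m ⊗[ℤ] P) ⧸ tensRel X m P))

instance : Module A (Tens X m P) :=
  inferInstanceAs (Module A ((X.Form m ⊗[ℤ] P) ⧸ tensRel X m P))

variable {m P}

/-- The pure tensor `ω ⊗_A p`. -/
def Tens.mk (ω : X.Form m) (p : P) : Tens X m P := (tensRel X m P).mkQ (ω ⊗ₜ[ℤ] p)

variable {X}

lemma Tens.mk_add (ω : X.Form m) (p q : P) : mk X ω (p + q) = mk X ω p + mk X ω q := by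
  simp only [mk, TensorProduct.tmul_add, map_add]; rfl

lemma Tens.add_mk (ω η : X.Form m) (p : P) : mk X (ω + η) p = mk X ω p + mk X η p := by
  simp only [mk, TensorProduct.add_tmul, map_add]; rfl

lemma Tens.mk_zero (ω : X.Form m) : mk X ω (0 : P) = 0 := by
  simp only [mk, TensorProduct.tmul_zero, map_zero]; rfl

lemma Tens.zero_mk (p : P) : mk X (0 : X.Form m) p = 0 := by
  simp only [mk, TensorProduct.zero_tmul, map_zero]; rfl

lemma Tens.smul_mk (a : A) (ω : X.Form m) (p : P) : a • mk X ω p = mk X (a • ω) p := rfl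

lemma Tens.rmul_mk (ω : X.Form m) (a : A) (p : P) : mk X (ω.rmul a) p = mk X ω (a • p) := by
  refine (Submodule.Quotient.eq (tensRel X m P)).2 (Submodule.subset_span ?_)
  exact ⟨ω, a, p, rfl⟩

lemma Tens.induction {motive : Tens X m P → Prop} (zero : motive 0)
    (mk : ∀ ω p, motive (Tens.mk X ω p)) (add : ∀ s t, motive s → motive t → motive (s + t))
    (t : Tens X m P) : motive t := by
  obtain ⟨t, rfl⟩ := Submodule.Quotient.mk_surjective (tensRel X m P) t
  induction t using TensorProduct.induction_on with
  | zero => exact zero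
  | tmul ω p => exact mk ω p
  | add s t hs ht => exact add _ _ hs ht

/-- The universal property of `Ω_d^m ⊗_A P`: a biadditive balanced map induces an additive map. -/
def Tens.lift {G : Type u} [AddCommGroup G] (f : X.Form m →+ P →+ G)
    (hf : ∀ ω a p, f (ω.rmul a) p = f ω (a • p)) : Tens X m P →+ G :=
  QuotientAddGroup.lift (tensRel X m P).toAddSubgroup
    (TensorProduct.liftAddHom f (fun r ω p => by simp)) (by
      intro t ht
      replace ht : t ∈ tensRel X m P := ht
      rw [AddMonoidHom.mem_ker]
      induction ht using Submodule.closure_induction with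
      | zero => simp
      | add s t _ _ hs ht => rw [map_add, hs, ht, add_zero]
      | smul_mem b t hb =>
        obtain ⟨ω, a, p, rfl⟩ := hb
        have h := hf (b • ω) a p
        have e : (b • ω).rmul a = b • ω.rmul a := by ext; simp [mul_assoc]
        rw [e] at h
        rw [smul_sub, TensorProduct.smul_tmul', TensorProduct.smul_tmul', map_sub]
        simpa [sub_eq_zero] using h)

@[simp] lemma Tens.lift_mk {G : Type u} [AddCommGroup G] (f : X.Form m →+ P →+ G)
    (hf : ∀ ω a p, f (ω.rmul a) p = f ω (a • p)) (ω : X.Form m) (p : P) :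
    Tens.lift f hf (Tens.mk X ω p) = f ω p := rfl

/-- The tensor product as a biadditive map. -/
def Tens.mkHom (X : ExteriorCalculus k A) (m : ℕ) (P : Type u) [AddCommGroup P] [Module A P] :
    X.Form m →+ P →+ Tens X m P :=
  AddMonoidHom.mk' (fun ω => AddMonoidHom.mk' (fun p => Tens.mk X ω p) (Tens.mk_add ω))
    (fun ω η => by ext p; exact Tens.add_mk ω η p)

@[simp] lemma Tens.mkHom_apply (ω : X.Form m) (p : P) : Tens.mkHom X m P ω p = Tens.mk X ω p := rfl

/-- Functoriality: `id ⊗_A f : Ω_d^m ⊗_A P → Ω_d^m ⊗_A Q` for an `A`-linear map `f : P → Q`. -/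
def Tens.map {Q : Type u} [AddCommGroup Q] [Module A Q] (f : P →ₗ[A] Q) :
    Tens X m P →ₗ[A] Tens X m Q where
  toFun := Tens.lift ((AddMonoidHom.compHom' f.toAddMonoidHom).comp (Tens.mkHom X m Q))
    (fun ω a p => by simp [Tens.rmul_mk])
  map_add' := map_add _
  map_smul' a t := by
    induction t using Tens.induction with
    | zero => simp
    | mk ω p => simp [Tens.smul_mk]
    | add s t hs ht => rw [smul_add, map_add, hs, ht, map_add, smul_add]

@[simp] lemma Tens.map_mk {Q : Type u} [AddCommGroup Q] [Module A Q] (f : P →ₗ[A] Q)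
    (ω : X.Form m) (p : P) : Tens.map f (Tens.mk X ω p) = Tens.mk X ω (f p) := rfl

/-- Left wedge multiplication by `ω`, as a map `Ω_d^n ⊗_A P → Ω_d^{m+n} ⊗_A P`. -/
def Tens.wedge {n l : ℕ} (h : m + n = l) (ω : X.Form m) : Tens X n P →+ Tens X l P :=
  Tens.lift (AddMonoidHom.mk' (fun η => Tens.mkHom X l P (ω.wedge h η))
      (fun η θ => by rw [← map_add]; congr 1; ext; simp [mul_add]))
    (fun η a p => by
      have : ω.wedge h (η.rmul a) = (ω.wedge h η).rmul a := by ext; simp [mul_assoc]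
      simp [this, Tens.rmul_mk])

@[simp] lemma Tens.wedge_mk {n l : ℕ} (h : m + n = l) (ω : X.Form m) (η : X.Form n) (p : P) :
    Tens.wedge h ω (Tens.mk X η p) = Tens.mk X (ω.wedge h η) p := by
  simp [Tens.wedge]

lemma Tens.wedge_add {n l : ℕ} (h : m + n = l) (ω η : X.Form m) (t : Tens X n P) :
    Tens.wedge h (ω + η) t = Tens.wedge h ω t + Tens.wedge h η t := by
  induction t using Tens.induction with
  | zero => simp
  | mk θ p =>
    have : (ω + η).wedge h θ = ω.wedge h θ + η.wedge h θ := by ext; simp [add_mul]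
    simp [this, Tens.add_mk]
  | add s t hs ht => simp only [map_add, hs, ht]; abel

lemma Tens.wedge_rmul {n l : ℕ} (h : m + n = l) (ω : X.Form m) (a : A) (t : Tens X n P) :
    Tens.wedge h (ω.rmul a) t = Tens.wedge h ω (a • t) := by
  induction t using Tens.induction with
  | zero => simp
  | mk θ p =>
    have : (ω.rmul a).wedge h θ = ω.wedge h (a • θ) := by ext; simp [mul_assoc]
    simp [this, Tens.smul_mk]
  | add s t hs ht => simp only [map_add, smul_add, hs, ht]

lemma Tens.wedge_smul {n l : ℕ} (h : m + n = l) (ω : X.Form m) (a : A) (t : Tens X n P) :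
    Tens.wedge h (a • ω) t = a • Tens.wedge h ω t := by
  induction t using Tens.induction with
  | zero => simp
  | mk θ p =>
    have : (a • ω).wedge h θ = a • ω.wedge h θ := by ext; simp [mul_assoc]
    simp [this, Tens.smul_mk]
  | add s t hs ht => simp only [map_add, smul_add, hs, ht]

end Tens

/-! ### The 1-jet functor

`J_d^1 P = J_d^1 A ⊗_A P`, where `J_d^1 A` is the quotient of `A ⊗ A` by the kernel of the map
`∑ a_i ⊗ b_i ↦ (∑ a_i b_i, ∑ (da_i) b_i)`.  The class `[a ⊗ b] ⊗ p` corresponds to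
the pair `(abp, -(da) b ⊗ p)`, that is to its image under the two splittings `π^{1,0}` and `ρ` of
the `1`-jet sequence; this identifies `J_d^1 P` with `P × (Ω_d^1 ⊗_A P)` as an abelian group, with
the `A`-module structure `a (p, η) = (ap, aη - da ⊗ p)`. -/

section Jet

/-- The 1-jet module `J_d^1 P`. -/
@[ext] structure J1 (P : Type u) [AddCommGroup P] [Module A P] : Type u where
  /-- the 1-jet projection `π^{1,0} : J_d^1 P → P` -/
  pr : P
  /-- the `k`-linear splitting `ρ : J_d^1 P → Ω_d^1 ⊗_A P` -/
  rho : Tens X 1 P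

variable {X}
variable {P : Type u} [AddCommGroup P] [Module A P]

namespace J1

instance : Zero (J1 X P) := ⟨⟨0, 0⟩⟩
instance : Add (J1 X P) := ⟨fun ξ ζ => ⟨ξ.pr + ζ.pr, ξ.rho + ζ.rho⟩⟩
instance : Neg (J1 X P) := ⟨fun ξ => ⟨-ξ.pr, -ξ.rho⟩⟩
instance : Sub (J1 X P) := ⟨fun ξ ζ => ⟨ξ.pr - ζ.pr, ξ.rho - ζ.rho⟩⟩
instance : SMul A (J1 X P) := ⟨fun a ξ => ⟨a • ξ.pr, a • ξ.rho - Tens.mk X (X.dA a) ξ.pr⟩⟩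

@[simp] lemma zero_pr : (0 : J1 X P).pr = 0 := rfl
@[simp] lemma zero_rho : (0 : J1 X P).rho = 0 := rfl
@[simp] lemma add_pr (ξ ζ : J1 X P) : (ξ + ζ).pr = ξ.pr + ζ.pr := rfl
@[simp] lemma add_rho (ξ ζ : J1 X P) : (ξ + ζ).rho = ξ.rho + ζ.rho := rfl
@[simp] lemma neg_pr (ξ : J1 X P) : (-ξ).pr = -ξ.pr := rfl
@[simp] lemma neg_rho (ξ : J1 X P) : (-ξ).rho = -ξ.rho := rfl
@[simp] lemma sub_pr (ξ ζ : J1 X P) : (ξ - ζ).pr = ξ.pr - ζ.pr := rfl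
@[simp] lemma sub_rho (ξ ζ : J1 X P) : (ξ - ζ).rho = ξ.rho - ζ.rho := rfl
@[simp] lemma smul_pr (a : A) (ξ : J1 X P) : (a • ξ).pr = a • ξ.pr := rfl
@[simp] lemma smul_rho (a : A) (ξ : J1 X P) :
    (a • ξ).rho = a • ξ.rho - Tens.mk X (X.dA a) ξ.pr := rfl

instance : AddCommGroup (J1 X P) where
  add_assoc ξ ζ θ := by ext <;> simp [add_assoc]
  zero_add ξ := by ext <;> simp
  add_zero ξ := by ext <;> simp
  nsmul := nsmulRec
  zsmul := zsmulRec
  neg_add_cancel ξ := by ext <;> simp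
  add_comm ξ ζ := by ext <;> simp [add_comm]
  sub_eq_add_neg ξ ζ := by ext <;> simp [sub_eq_add_neg]

instance : Module A (J1 X P) where
  one_smul ξ := by ext <;> simp [dA_one, Tens.zero_mk]
  mul_smul a b ξ := by
    ext
    · simp [mul_smul]
    · simp [mul_smul, dA_mul, Tens.add_mk, Tens.rmul_mk, Tens.smul_mk, smul_sub]; abel
  smul_zero a := by ext <;> simp [Tens.mk_zero]
  smul_add a ξ ζ := by
    ext
    · simp
    · simp [Tens.mk_add]; abel
  add_smul a b ξ := by
    ext
    · simp [add_smul]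
    · simp [add_smul, dA_add, Tens.add_mk]; abel
  zero_smul ξ := by ext <;> simp [dA_zero, Tens.zero_mk]

/-- The 1-jet projection. -/
def proj : J1 X P →ₗ[A] P where
  toFun := J1.pr
  map_add' _ _ := rfl
  map_smul' _ _ := rfl

/-- The 1-jet prolongation `j_d^1`, which sends `p` to `[1 ⊗ 1] ⊗ p`. -/
def prolong (X : ExteriorCalculus k A) (p : P) : J1 X P := ⟨p, 0⟩

@[simp] lemma proj_apply (ξ : J1 X P) : proj ξ = ξ.pr := rfl

end J1

/-! ### Holonomic jets -/

/-- The Spencer operator `S_d^{1,1} : Ω_d^1 ⊗_A J_d^1 P → Ω_d^2 ⊗_A P`, which sends `ω ⊗ ξ` to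
`dω ⊗ π^{1,0}(ξ) + ω ∧ ρ(ξ)`, that is `ω ⊗ [a ⊗ b] ⊗ p` to `d(ωa) b ⊗ p`. -/
def spencer : Tens X 1 (J1 X P) →+ Tens X 2 P :=
  Tens.lift
    (AddMonoidHom.mk'
      (fun ω => AddMonoidHom.mk'
        (fun ξ => Tens.mk X ω.diff ξ.pr + Tens.wedge (rfl : 1 + 1 = 2) ω ξ.rho)
        (fun ξ ζ => by simp [Tens.mk_add]; abel))
      (fun ω η => by
        ext ξ
        have : (ω + η).diff = ω.diff + η.diff := by ext; simp
        simp [this, Tens.add_mk, Tens.wedge_add]; abel))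
    (fun ω a ξ => by
      have h1 : (ω.rmul a).diff = ω.diff.rmul a - ω.wedge (rfl : 1 + 1 = 2) (X.dA a) := by
        ext; simp [d_mul_ι]
      have h2 : Tens.mk X (ω.diff.rmul a - ω.wedge (rfl : 1 + 1 = 2) (X.dA a)) ξ.pr
          = Tens.mk X (ω.diff.rmul a) ξ.pr
            - Tens.mk X (ω.wedge (rfl : 1 + 1 = 2) (X.dA a)) ξ.pr :=
        map_sub ((Tens.mkHom X 2 P).flip ξ.pr) _ _
      simp [h1, h2, Tens.rmul_mk, Tens.wedge_rmul]; abel)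

lemma spencer_mk (ω : X.Form 1) (ξ : J1 X P) :
    spencer (Tens.mk X ω ξ)
      = Tens.mk X ω.diff ξ.pr + Tens.wedge (rfl : 1 + 1 = 2) ω ξ.rho := by
  simp [spencer]

lemma spencer_smul (a : A) (t : Tens X 1 (J1 X P)) :
    spencer (a • t) = a • spencer t
      + Tens.wedge (rfl : 1 + 1 = 2) (X.dA a) (Tens.map J1.proj t) := by
  induction t using Tens.induction with
  | zero => simp
  | mk ω ξ =>
    have : (a • ω).diff = (X.dA a).wedge (rfl : 1 + 1 = 2) ω + a • ω.diff := by
      ext; simp [d_ι_mul]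
    simp [Tens.smul_mk, spencer_mk, this, Tens.add_mk, Tens.wedge_smul]; abel
  | add s t hs ht => simp only [smul_add, map_add, hs, ht]; abel

variable {Q : Type u} [AddCommGroup Q] [Module A Q]

/-- The first component `D^I ∘ J_d^1(l)` of the holonomicity obstruction, for `l : P → J_d^1 Q`,
where `D^I : J_d^1 J_d^1 Q → Ω_d^1 ⊗_A Q` sends `[a ⊗ b] ⊗ [c ⊗ e]` to `a d(bc) ⊗ e`;
equivalently, `D^I` is the difference `J_d^1(π^{1,0}) - π^{1,0}_{J_d^1}`. -/
def obstrI (l : P →ₗ[A] J1 X Q) : J1 X P →+ Tens X 1 Q :=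
  AddMonoidHom.mk' (fun ξ => Tens.map (J1.proj ∘ₗ l) ξ.rho - (l ξ.pr).rho)
    (fun ξ ζ => by simp; abel)

/-- The second component `D^II ∘ J_d^1(l)` of the holonomicity obstruction, where
`D^II : J_d^1 J_d^1 Q → Ω_d^2 ⊗_A Q` sends `[a ⊗ b] ⊗ [c ⊗ e]` to `da ∧ d(bc) ⊗ e`;
equivalently, `D^II` is the composition of `ρ` and the Spencer operator. -/
def obstrII (l : P →ₗ[A] J1 X Q) : J1 X P →+ Tens X 2 Q :=
  AddMonoidHom.mk' (fun ξ => spencer (Tens.map l ξ.rho))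
    (fun ξ ζ => by simp)

lemma obstrI_smul (l : P →ₗ[A] J1 X Q) (a : A) (ξ : J1 X P) :
    obstrI l (a • ξ) = a • obstrI l ξ := by
  simp [obstrI, smul_sub]

lemma obstrII_smul (l : P →ₗ[A] J1 X Q) (a : A) (ξ : J1 X P) :
    obstrII l (a • ξ) = a • obstrII l ξ
      + Tens.wedge (rfl : 1 + 1 = 2) (X.dA a) (obstrI l ξ) := by
  have hd : ((X.dA a).diff : X.Form 2) = 0 := by ext; simp [X.d_d]
  have hm : Tens.map J1.proj (Tens.map l ξ.rho) = Tens.map (J1.proj ∘ₗ l) ξ.rho := by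
    induction ξ.rho using Tens.induction with
    | zero => simp
    | mk ω p => simp
    | add s t hs ht => simp only [map_add, hs, ht]
  simp [obstrI, obstrII, spencer_smul, spencer_mk, hd, hm, Tens.zero_mk]
  abel

/-- The kernel of `D ∘ J_d^1(l) : J_d^1 P → (Ω_d^1 ⋉ Ω_d^2) Q`, where `D = (D^I, D^II)`. -/
def holonomic (l : P →ₗ[A] J1 X Q) : Submodule A (J1 X P) where
  carrier := {ξ | obstrI l ξ = 0 ∧ obstrII l ξ = 0}
  add_mem' {ξ ζ} h h' := by simp [h.1, h.2, h'.1, h'.2]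
  zero_mem' := by simp
  smul_mem' a ξ h := by simp [obstrI_smul, obstrII_smul, h.1, h.2]

variable (X)

/-- Two consecutive holonomic jet modules `J_d^n E` and `J_d^{n+1} E`, with the inclusion of the
latter in `J_d^1 J_d^n E` and with the two prolongations. -/
structure JetStage (E : Type u) where
  /-- the module `J_d^n E` -/
  Prev : Type u
  [prevGroup : AddCommGroup Prev]
  [prevModule : Module A Prev]
  /-- the module `J_d^{n+1} E` -/
  Cur : Type u
  [curGroup : AddCommGroup Cur]
  [curModule : Module A Cur]
  l : Cur →ₗ[A] J1 X Prev
  jPrev : E → Prev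
  jCur : E → Cur
  l_jCur : ∀ e, l (jCur e) = J1.prolong X (jPrev e)

attribute [instance] JetStage.prevGroup JetStage.prevModule JetStage.curGroup JetStage.curModule

/-- `J_d^{n+2} E` is the kernel of `D ∘ J_d^1(l^{n+1}) : J_d^1 J_d^{n+1} E → (Ω_d^1 ⋉ Ω_d^2) J_d^n E`
and `j_d^{n+2}` is the unique factorization of `j_d^1 ∘ j_d^{n+1}` through it. -/
def JetStage.next {E : Type u} (S : JetStage X E) : JetStage X E where
  Prev := S.Cur
  Cur := holonomic S.l
  l := (holonomic S.l).subtype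
  jPrev := S.jCur
  jCur e := ⟨J1.prolong X (S.jCur e), by
    constructor
    · simp [obstrI, J1.prolong, S.l_jCur]
    · simp [obstrII, J1.prolong]⟩
  l_jCur _ := rfl

variable (E : Type u) [AddCommGroup E] [Module A E]

/-- The pair of `J_d^n E` and `J_d^{n+1} E`, starting from `J_d^0 E = E` and `J_d^1 E`. -/
def jetStage : ℕ → JetStage X E
  | 0 =>
    { Prev := E
      Cur := J1 X E
      l := LinearMap.id
      jPrev := id
      jCur := J1.prolong X
      l_jCur := fun _ => rfl }
  | n + 1 => (jetStage n).next

/-- The holonomic `n`-jet module `J_d^n E`. -/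
def Jet (n : ℕ) : Type u := (jetStage X E n).Prev

instance (n : ℕ) : AddCommGroup (Jet X E n) := (jetStage X E n).prevGroup
instance (n : ℕ) : Module A (Jet X E n) := (jetStage X E n).prevModule

variable {E}

/-- The `n`-jet prolongation `j_d^n : E → J_d^n E`. -/
def jet (n : ℕ) : E → Jet X E n := (jetStage X E n).jPrev

variable (E)

/-- The inclusion `l_d^{n+1} : J_d^{n+1} E → J_d^1 J_d^n E`. -/
def jetIncl (n : ℕ) : Jet X E (n + 1) →ₗ[A] J1 X (Jet X E n) := (jetStage X E n).l

/-- The jet projection `π_d^{n+1,n} : J_d^{n+1} E → J_d^n E`. -/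
def jetProj (n : ℕ) : Jet X E (n + 1) →ₗ[A] Jet X E n := J1.proj ∘ₗ jetIncl X E n

lemma jetProj_jet (n : ℕ) (e : E) : jetProj X E n (jet X (n + 1) e) = jet X n e :=
  congrArg J1.pr ((jetStage X E n).l_jCur e)

end Jet

/-! ### Linear differential operators and symbols -/

section Diff

variable (E : Type u) [AddCommGroup E] [Module k E] [Module A E]
variable (F : Type u) [AddCommGroup F] [Module k F] [Module A F] [IsScalarTower k A F]

/-- `Diff_d^n(E, F)`: the linear differential operators of order at most `n`, that is the `k`-linear
maps `Δ : E → F` that factor as an `A`-linear map `J_d^n E → F` after `j_d^n`; as a module over the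
ring `Hom_A(F, F)`, which acts by composition. -/
def DiffOrd (n : ℕ) : Submodule (Module.End A F) (E →ₗ[k] F) where
  carrier := {Δ | ∃ L : Jet X E n →ₗ[A] F, ∀ e, L (jet X n e) = Δ e}
  add_mem' := by
    rintro Δ Δ' ⟨L, hL⟩ ⟨L', hL'⟩
    exact ⟨L + L', fun e => by simp [hL, hL']⟩
  zero_mem' := ⟨0, fun e => rfl⟩
  smul_mem' := by
    rintro f Δ ⟨L, hL⟩
    exact ⟨f ∘ₗ L, fun e => by simp [hL]⟩

lemma diffOrd_le_succ (n : ℕ) : DiffOrd X E F n ≤ DiffOrd X E F (n + 1) := by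
  rintro Δ ⟨L, hL⟩
  exact ⟨L ∘ₗ jetProj X E n, fun e => by simp [jetProj_jet, hL]⟩

lemma diffOrd_mono : Monotone (DiffOrd X E F) := monotone_nat_of_le_succ (diffOrd_le_succ X E F)

/-- `Diff_d(E, F)`: the linear differential operators of finite order. -/
def Diff : Submodule (Module.End A F) (E →ₗ[k] F) where
  carrier := {Δ | ∃ n, Δ ∈ DiffOrd X E F n}
  add_mem' := by
    rintro Δ Δ' ⟨n, h⟩ ⟨n', h'⟩
    exact ⟨max n n', add_mem (diffOrd_mono X E F (le_max_left n n') h)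
      (diffOrd_mono X E F (le_max_right n n') h')⟩
  zero_mem' := ⟨0, zero_mem _⟩
  smul_mem' := by
    rintro f Δ ⟨n, h⟩
    exact ⟨n, Submodule.smul_mem _ f h⟩

lemma diffOrd_le (n : ℕ) : DiffOrd X E F n ≤ Diff X E F := fun _ h => ⟨n, h⟩

/-- `Diff_d^{n-1}(E, F)`, with the convention `Diff_d^{-1}(E, F) = 0`. -/
def DiffPred : ℕ → Submodule (Module.End A F) (E →ₗ[k] F)
  | 0 => ⊥
  | n + 1 => DiffOrd X E F n

/-- The symbols of order `n`: `Symb_d^n(E, F) = Diff_d^n(E, F) / Diff_d^{n-1}(E, F)`. -/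
def Symb (n : ℕ) : Type u := DiffOrd X E F n ⧸ (DiffPred X E F n).submoduleOf (DiffOrd X E F n)

instance (n : ℕ) : AddCommGroup (Symb X E F n) := inferInstanceAs
  (AddCommGroup (DiffOrd X E F n ⧸ (DiffPred X E F n).submoduleOf (DiffOrd X E F n)))

instance (n : ℕ) : Module (Module.End A F) (Symb X E F n) := inferInstanceAs
  (Module (Module.End A F) (DiffOrd X E F n ⧸ (DiffPred X E F n).submoduleOf (DiffOrd X E F n)))

instance (n : ℕ) : Module k (Symb X E F n) := inferInstanceAs
  (Module k (DiffOrd X E F n ⧸ (DiffPred X E F n).submoduleOf (DiffOrd X E F n)))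

/-- The symbol map `ς_d^n : Diff_d^n(E, F) → Symb_d^n(E, F)`. -/
def symbol (n : ℕ) : DiffOrd X E F n →ₗ[Module.End A F] Symb X E F n :=
  ((DiffPred X E F n).submoduleOf (DiffOrd X E F n)).mkQ

lemma symbol_surjective (n : ℕ) : Function.Surjective (symbol X E F n) :=
  Submodule.mkQ_surjective _

lemma symbol_eq_zero_iff (n : ℕ) (Δ : DiffOrd X E F n) :
    symbol X E F n Δ = 0 ↔ (Δ : E →ₗ[k] F) ∈ DiffPred X E F n :=
  Submodule.Quotient.mk_eq_zero _

/-- The graded symbol module `Symb_d^•(E, F) = ⨁ n, Symb_d^n(E, F)`. -/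
abbrev SymbTotal : Type u := ⨁ n, Symb X E F n

/-! ### Quantizations and total symbols -/

/-- A full quantization for `(E, F)`: for every `n` an `n`-quantization, that is
a `Hom_A(F, F)`-linear right splitting `q^n` of the symbol map `ς_d^n`. -/
structure Quantization where
  q : ∀ n, Symb X E F n →ₗ[Module.End A F] DiffOrd X E F n
  symbol_q : ∀ n σ, symbol X E F n (q n σ) = σ

namespace Quantization

variable {X E F} (Q : Quantization X E F)

/-- The full quantization as a map `q = ∑ q^n : Symb_d^•(E, F) → Diff_d(E, F)`. -/
def total : SymbTotal X E F →ₗ[Module.End A F] Diff X E F :=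
  DirectSum.toModule _ _ _ (fun n => Submodule.inclusion (diffOrd_le X E F n) ∘ₗ Q.q n)

/-- The step `T ↦ T - q^{m+1}(ς_d^{m+1}(T))` of the recursion for truncations; it lands in
`Diff_d^m(E, F)` as the symbol of the result vanishes. -/
def truncStep (m : ℕ) (T : DiffOrd X E F (m + 1)) : DiffOrd X E F m :=
  ⟨(T - Q.q (m + 1) (symbol X E F (m + 1) T) : DiffOrd X E F (m + 1)), by
    have h : symbol X E F (m + 1) (T - Q.q (m + 1) (symbol X E F (m + 1) T)) = 0 := by
      rw [map_sub, Q.symbol_q, sub_self]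
    exact (symbol_eq_zero_iff X E F (m + 1) _).1 h⟩

/-- The `m`-truncation of a differential operator `Δ` of order at most `n`: it is `Δ` for `m ≥ n`,
and below `n` it is given by descending recursion. -/
def truncOf (n : ℕ) (Δ : DiffOrd X E F n) (m : ℕ) : DiffOrd X E F m :=
  if h : m ≤ n then
    Nat.decreasingInduction (motive := fun i _ => DiffOrd X E F i)
      (fun i _ T => Q.truncStep i T) Δ h
  else Submodule.inclusion (diffOrd_mono X E F (not_le.1 h).le) Δ

open Classical in
/-- The order of a differential operator of finite order. -/
def order (Δ : Diff X E F) : ℕ := Nat.find Δ.2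

lemma mem_order (Δ : Diff X E F) : (Δ : E →ₗ[k] F) ∈ DiffOrd X E F (order Δ) := by
  classical exact Nat.find_spec Δ.2

/-- The `m`-truncation of a differential operator of finite order. -/
def trunc (Δ : Diff X E F) (m : ℕ) : DiffOrd X E F m := Q.truncOf (order Δ) ⟨Δ, mem_order Δ⟩ m

/-- The component `[Δ]_q^m = ς_d^m(trunc_m Δ)`. -/
def part (Δ : Diff X E F) (m : ℕ) : Symb X E F m := symbol X E F m (Q.trunc Δ m)

lemma part_eq_zero (Δ : Diff X E F) (m : ℕ) (h : order Δ < m) : Q.part Δ m = 0 := by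
  obtain ⟨m, rfl⟩ := Nat.exists_eq_succ_of_ne_zero (Nat.ne_of_gt (Nat.zero_lt_of_lt h))
  refine (symbol_eq_zero_iff X E F (m + 1) _).2 ?_
  change ((Q.trunc Δ (m + 1) : DiffOrd X E F (m + 1)) : E →ₗ[k] F) ∈ DiffOrd X E F m
  rw [trunc, truncOf, dif_neg (not_le.2 h)]
  exact diffOrd_mono X E F (Nat.lt_succ_iff.1 h) (mem_order Δ)

/-- The total symbol `ς_q(Δ) = ∑_m [Δ]_q^m`, the element of `Symb_d^•(E, F)` with the components
`[Δ]_q^m`. -/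
def totalSymbol (Δ : Diff X E F) : SymbTotal X E F :=
  DirectSum.mk (fun m => Symb X E F m) (Finset.range (order Δ + 1)) (fun m => Q.part Δ m)

lemma totalSymbol_apply (Δ : Diff X E F) (m : ℕ) : Q.totalSymbol Δ m = Q.part Δ m := by
  by_cases h : m ∈ Finset.range (order Δ + 1)
  · exact DirectSum.mk_apply_of_mem h
  · rw [Q.part_eq_zero Δ m (by simpa using h)]
    exact DirectSum.mk_apply_of_notMem h

/-- The `m`-homogeneous component `Δ_q^{(m)} = q^m([Δ]_q^m)` of `Δ`. -/
def component (Δ : Diff X E F) (m : ℕ) : Diff X E F :=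
  Submodule.inclusion (diffOrd_le X E F m) (Q.q m (Q.part Δ m))

end Quantization

end Diff

/-! ### Naturality in the second argument -/

section Naturality

variable (E : Type u) [AddCommGroup E] [Module k E] [Module A E]

section Maps

variable {F : Type u} [AddCommGroup F] [Module k F] [Module A F] [IsScalarTower k A F]
variable {G : Type u} [AddCommGroup G] [Module k G] [Module A G] [IsScalarTower k A G]

/-- Composition with an `A`-linear map `f : F → G`, as a map `Diff_d^n(E, F) → Diff_d^n(E, G)`. -/
def DiffOrd.map (f : F →ₗ[A] G) (n : ℕ) : DiffOrd X E F n →ₗ[k] DiffOrd X E G n where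
  toFun Δ := ⟨f.restrictScalars k ∘ₗ Δ.1, by
    obtain ⟨L, hL⟩ := Δ.2
    exact ⟨f ∘ₗ L, fun e => by simp [hL]⟩⟩
  map_add' _ _ := Subtype.ext (LinearMap.comp_add _ _ _)
  map_smul' c Δ := Subtype.ext (by ext e; exact (f.restrictScalars k).map_smul c (Δ.1 e))

/-- Composition with an `A`-linear map `f : F → G`, as a map `Diff_d(E, F) → Diff_d(E, G)`. -/
def Diff.map (f : F →ₗ[A] G) : Diff X E F →ₗ[k] Diff X E G where
  toFun Δ := ⟨f.restrictScalars k ∘ₗ Δ.1, by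
    obtain ⟨n, h⟩ := Δ.2
    exact ⟨n, (DiffOrd.map X E f n ⟨Δ.1, h⟩).2⟩⟩
  map_add' _ _ := Subtype.ext (LinearMap.comp_add _ _ _)
  map_smul' c Δ := Subtype.ext (by ext e; exact (f.restrictScalars k).map_smul c (Δ.1 e))

/-- The symbol map as a `k`-linear map. -/
def symbolK (F : Type u) [AddCommGroup F] [Module k F] [Module A F] [IsScalarTower k A F]
    (n : ℕ) : DiffOrd X E F n →ₗ[k] Symb X E F n :=
  { symbol X E F n with map_smul' := fun _ _ => rfl }

/-- The inclusion of `Diff_d^n(E, F)` in `Diff_d(E, F)` as a `k`-linear map. -/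
def diffInclK (F : Type u) [AddCommGroup F] [Module k F] [Module A F] [IsScalarTower k A F]
    (n : ℕ) : DiffOrd X E F n →ₗ[k] Diff X E F :=
  { Submodule.inclusion (diffOrd_le X E F n) with map_smul' := fun _ _ => rfl }

/-- The map `Symb_d^n(E, F) → Symb_d^n(E, G)` induced by an `A`-linear map `f : F → G`. -/
def Symb.map (f : F →ₗ[A] G) (n : ℕ) : Symb X E F n →ₗ[k] Symb X E G n where
  toFun := QuotientAddGroup.map
    ((DiffPred X E F n).submoduleOf (DiffOrd X E F n)).toAddSubgroup
    ((DiffPred X E G n).submoduleOf (DiffOrd X E G n)).toAddSubgroup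
    (DiffOrd.map X E f n).toAddMonoidHom (by
    rintro Δ hΔ
    cases n with
    | zero =>
      have h : (Δ : E →ₗ[k] F) = 0 := hΔ
      change f.restrictScalars k ∘ₗ (Δ : E →ₗ[k] F) = 0
      rw [h, LinearMap.comp_zero]
    | succ n => exact (DiffOrd.map X E f n ⟨Δ.1, hΔ⟩).2)
  map_add' σ τ := map_add (QuotientAddGroup.map _ _ _ _) σ τ
  map_smul' c σ := by
    obtain ⟨Δ, rfl⟩ := symbol_surjective X E _ _ σ
    exact congrArg (symbolK X E G n) ((DiffOrd.map X E f n).map_smul c Δ)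

lemma Symb.map_symbol (f : F →ₗ[A] G) (n : ℕ) (Δ : DiffOrd X E F n) :
    Symb.map X E f n (symbol X E F n Δ) = symbol X E G n (DiffOrd.map X E f n Δ) := rfl

end Maps

/-- The canonical `k`-module structure on a left `A`-module. -/
@[reducible]
def canonicalModule (k : Type w) [CommRing k] {A : Type u} [Ring A] [Algebra k A]
    (F : ModuleCat.{u} A) : Module k F := Module.restrictScalars k A F

attribute [local instance] canonicalModule

lemma canonicalModule_tower (k : Type w) [CommRing k] {A : Type u} [Ring A] [Algebra k A]
    (F : ModuleCat.{u} A) : IsScalarTower k A F := IsScalarTower.restrictScalars k A F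

attribute [local instance] canonicalModule_tower

/-- The functor `Diff_d^n(E, -)` from left `A`-modules to `k`-modules. -/
def diffOrdFunctor (n : ℕ) : ModuleCat.{u} A ⥤ ModuleCat.{u} k where
  obj F := ModuleCat.of k (DiffOrd X E F n)
  map f := ModuleCat.ofHom (DiffOrd.map X E f.hom n)

/-- The functor `Diff_d(E, -)` from left `A`-modules to `k`-modules. -/
def diffFunctor : ModuleCat.{u} A ⥤ ModuleCat.{u} k where
  obj F := ModuleCat.of k (Diff X E F)
  map f := ModuleCat.ofHom (Diff.map X E f.hom)

/-- The functor `Symb_d^n(E, -)` from left `A`-modules to `k`-modules. -/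
def symbFunctor (n : ℕ) : ModuleCat.{u} A ⥤ ModuleCat.{u} k where
  obj F := ModuleCat.of k (Symb X E F n)
  map f := ModuleCat.ofHom (Symb.map X E f.hom n)
  map_id F := by
    ext σ
    obtain ⟨Δ, rfl⟩ := symbol_surjective X E _ _ σ
    rfl
  map_comp f g := by
    ext σ
    obtain ⟨Δ, rfl⟩ := symbol_surjective X E _ _ σ
    rfl

/-- The functor `Symb_d^•(E, -)` from left `A`-modules to `k`-modules. -/
def symbTotalFunctor : ModuleCat.{u} A ⥤ ModuleCat.{u} k where
  obj F := ModuleCat.of k (SymbTotal X E F)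
  map f := ModuleCat.ofHom (DirectSum.lmap (fun n => Symb.map X E f.hom n))
  map_id F := by
    ext n σ : 3
    obtain ⟨Δ, rfl⟩ := symbol_surjective X E _ _ σ
    simp
    rfl
  map_comp f g := by
    ext n σ : 3
    obtain ⟨Δ, rfl⟩ := symbol_surjective X E _ _ σ
    simp
    rfl

/-- The symbol map as a natural transformation `Diff_d^n(E, -) → Symb_d^n(E, -)`. -/
def symbolNat (n : ℕ) : diffOrdFunctor X E n ⟶ symbFunctor X E n where
  app F := ModuleCat.ofHom (symbolK X E F n)

/-- A natural full quantization for `E`: for every `n` a natural `n`-quantization, that is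
a natural transformation `q^n : Symb_d^n(E, -) → Diff_d^n(E, -)` of functors from left
`A`-modules to `k`-modules with `ς_d^n ∘ q^n = id`. -/
structure NaturalQuantization where
  q : ∀ n, symbFunctor X E n ⟶ diffOrdFunctor X E n
  q_symbol : ∀ n, q n ≫ symbolNat X E n = 𝟙 (symbFunctor X E n)

namespace NaturalQuantization

variable {X E} (Q : NaturalQuantization X E)

/-- The component `q_F^n : Symb_d^n(E, F) → Diff_d^n(E, F)`. -/
def qHom (n : ℕ) (F : ModuleCat.{u} A) : Symb X E F n →ₗ[k] DiffOrd X E F n :=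
  ((Q.q n).app F).hom

/-- The component of a natural full quantization at `F`, a full quantization for `(E, F)`;
its linearity over `Hom_A(F, F)` is the naturality with respect to endomorphisms of `F`. -/
def onModule (F : ModuleCat.{u} A) : Quantization X E F where
  q n :=
    { toFun := Q.qHom n F
      map_add' := map_add _
      map_smul' := fun f σ => by
        obtain ⟨Δ, rfl⟩ := symbol_surjective X E _ _ σ
        exact congrArg (fun φ => φ.hom (symbol X E F n Δ)) ((Q.q n).naturality (ModuleCat.ofHom f)) }
  symbol_q n σ := congrArg (fun φ => (φ.app F).hom σ) (Q.q_symbol n)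

/-- A natural full quantization as a natural transformation
`q = ∑ q^n : Symb_d^•(E, -) → Diff_d(E, -)`. -/
def total : symbTotalFunctor X E ⟶ diffFunctor X E where
  app F := ModuleCat.ofHom (DirectSum.toModule k ℕ (Diff X E F)
    (fun n => diffInclK X E F n ∘ₗ Q.qHom n F))
  naturality F G f := by
    refine ModuleCat.hom_ext (DirectSum.linearMap_ext k fun n => LinearMap.ext fun σ => ?_)
    have h := congrArg (fun φ => diffInclK X E G n (φ.hom σ)) ((Q.q n).naturality f)
    change DirectSum.toModule k ℕ (Diff X E G)
        (fun n => diffInclK X E G n ∘ₗ Q.qHom n G)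
        (DirectSum.lmap (fun n => Symb.map X E f.hom n) (DirectSum.lof k ℕ (Symb X E F) n σ))
      = Diff.map X E f.hom (DirectSum.toModule k ℕ (Diff X E F)
        (fun n => diffInclK X E F n ∘ₗ Q.qHom n F) (DirectSum.lof k ℕ (Symb X E F) n σ))
    rw [DirectSum.lmap_lof, DirectSum.toModule_lof, DirectSum.toModule_lof]
    exact h

/-- The total symbol maps `ς_{q_F} : Diff_d(E, F) → Symb_d^•(E, F)`. -/
def totalSymbol (F : ModuleCat.{u} A) :
    (diffFunctor X E).obj F → (symbTotalFunctor X E).obj F :=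
  (Q.onModule F).totalSymbol

end NaturalQuantization

end Naturality

end NCJet

end

/-! A full quantization picks, for each `n`, a complement `range (q n)` of `Diff_d^{n-1}` in
`Diff_d^n`. Looking at the term of highest degree shows that these complements are independent,
so `q` is injective. Successive truncations of `Δ` differ by the homogeneous components of `Δ`,
so the components telescope to `Δ`, that is `q ∘ ς_q = id`; injectivity of `q` turns `ς_q` into
a two-sided inverse, whose naturality in `F` follows from that of `q`. -/

noncomputable section

namespace NCJet

section DirectSum

variable {R M ι : Type*} {S : ι → Type*}

lemma toModule_eq_sum [Semiring R] [AddCommMonoid M] [Module R M] [∀ i, AddCommMonoid (S i)]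
    [∀ i, Module R (S i)] [DecidableEq ι] (q : ∀ i, S i →ₗ[R] M) (σ : ⨁ i, S i)
    {s : Finset ι} (hs : ∀ i ∉ s, σ i = 0) :
    DirectSum.toModule R ι M q σ = ∑ i ∈ s, q i (σ i) := by
  classical
  have hsupp : DFinsupp.support σ ⊆ s := fun i hi =>
    by_contra fun his => DFinsupp.mem_support_iff.1 hi (hs i his)
  calc DirectSum.toModule R ι M q σ = ∑ i ∈ DFinsupp.support σ, q i (σ i) :=
        DFinsupp.sumAddHom_apply (fun i => (q i).toAddMonoidHom) σ
    _ = ∑ i ∈ s, q i (σ i) := Finset.sum_subset hsupp fun i _ hi => by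
        rw [DFinsupp.notMem_support_iff.1 hi, map_zero]

lemma toModule_injective_of_filtration [Ring R] [AddCommGroup M] [Module R M]
    [∀ i, AddCommGroup (S i)] [∀ i, Module R (S i)] [LinearOrder ι] (W : ι → Submodule R M)
    (q : ∀ i, S i →ₗ[R] M) (q_mem : ∀ ⦃i j⦄, i < j → ∀ s, q i s ∈ W j)
    (eq_zero_of_mem : ∀ i s, q i s ∈ W i → s = 0) :
    Function.Injective (DirectSum.toModule R ι M q) := by
  classical
  refine (injective_iff_map_eq_zero _).2 fun σ hσ => ?_
  by_contra hne
  have hsupp : (DFinsupp.support σ).Nonempty :=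
    Finset.nonempty_iff_ne_empty.2 fun h => hne (DFinsupp.support_eq_empty.1 h)
  obtain ⟨n, hn, hmax⟩ := (DFinsupp.support σ).exists_max_image id hsupp
  have hsum : q n (σ n) + ∑ i ∈ (DFinsupp.support σ).erase n, q i (σ i) = 0 := by
    rw [Finset.add_sum_erase _ (fun i => q i (σ i)) hn, ← hσ]
    exact (toModule_eq_sum q σ fun i hi => DFinsupp.notMem_support_iff.1 hi).symm
  have hlower : ∑ i ∈ (DFinsupp.support σ).erase n, q i (σ i) ∈ W n := sum_mem fun i hi =>
    q_mem ((hmax i (Finset.mem_of_mem_erase hi)).lt_of_ne (Finset.ne_of_mem_erase hi)) (σ i)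
  refine DFinsupp.mem_support_iff.1 hn (eq_zero_of_mem n (σ n) ?_)
  rw [eq_neg_of_add_eq_zero_left hsum]
  exact neg_mem hlower

end DirectSum

variable {k : Type w} [CommRing k] {A : Type u} [Ring A] [Algebra k A]
variable {X : ExteriorCalculus k A}
variable {E : Type u} [AddCommGroup E] [Module k E] [Module A E]

section Filtration

variable {F : Type u} [AddCommGroup F] [Module k F] [Module A F] [IsScalarTower k A F]

lemma diffOrd_le_diffPred {m n : ℕ} (h : m < n) : DiffOrd X E F m ≤ DiffPred X E F n := by
  cases n with
  | zero => exact absurd h m.not_lt_zero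
  | succ n => exact diffOrd_mono X E F (Nat.lt_succ_iff.1 h)

lemma symbol_zero_injective : Function.Injective (symbol X E F 0) :=
  (injective_iff_map_eq_zero _).2 fun Δ hΔ => Subtype.ext ((symbol_eq_zero_iff X E F 0 Δ).1 hΔ)

end Filtration

namespace Quantization

variable {F : Type u} [AddCommGroup F] [Module k F] [Module A F] [IsScalarTower k A F]
variable (Q : Quantization X E F)

lemma coe_trunc_of_order_le {Δ : Diff X E F} {m : ℕ} (h : order Δ ≤ m) :
    (Q.trunc Δ m : E →ₗ[k] F) = Δ := by
  obtain rfl | hlt := h.eq_or_lt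
  · rw [trunc, truncOf, dif_pos le_rfl, Nat.decreasingInduction_self]
  · rw [trunc, truncOf, dif_neg hlt.not_ge]
    rfl

lemma trunc_of_lt_order {Δ : Diff X E F} {m : ℕ} (h : m < order Δ) :
    Q.trunc Δ m = Q.truncStep m (Q.trunc Δ (m + 1)) := by
  rw [trunc, trunc, truncOf, truncOf, dif_pos h.le, dif_pos (Nat.succ_le_of_lt h),
    Nat.decreasingInduction_succ_left]

lemma component_eq_zero {Δ : Diff X E F} {m : ℕ} (h : order Δ < m) : Q.component Δ m = 0 := by
  rw [component, Q.part_eq_zero Δ m h, map_zero, map_zero]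

lemma coe_component_zero (Δ : Diff X E F) :
    (Q.component Δ 0 : E →ₗ[k] F) = Q.trunc Δ 0 :=
  congrArg Subtype.val (symbol_zero_injective (Q.symbol_q 0 (symbol X E F 0 (Q.trunc Δ 0))))

lemma trunc_add_component_succ (Δ : Diff X E F) (m : ℕ) :
    (Q.trunc Δ m + Q.component Δ (m + 1) : E →ₗ[k] F) = Q.trunc Δ (m + 1) := by
  obtain h | h := lt_or_ge m (order Δ)
  · rw [Q.trunc_of_lt_order h]
    exact sub_add_cancel _ _
  · rw [Q.component_eq_zero (Nat.lt_succ_of_le h), Q.coe_trunc_of_order_le h,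
      Q.coe_trunc_of_order_le (h.trans m.le_succ), ZeroMemClass.coe_zero, add_zero]

lemma sum_range_component_eq_trunc (Δ : Diff X E F) (m : ℕ) :
    ∑ i ∈ Finset.range (m + 1), (Q.component Δ i : E →ₗ[k] F) = Q.trunc Δ m := by
  induction m with
  | zero => rw [Finset.sum_range_one, coe_component_zero]
  | succ m ih => rw [Finset.sum_range_succ, ih, trunc_add_component_succ]

lemma sum_range_order_component (Δ : Diff X E F) :
    ∑ i ∈ Finset.range (order Δ + 1), Q.component Δ i = Δ := by
  refine Subtype.ext ?_
  rw [AddSubmonoidClass.coe_finsetSum, sum_range_component_eq_trunc,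
    Q.coe_trunc_of_order_le le_rfl]

lemma support_component_subset (Δ : Diff X E F) :
    Function.support (Q.component Δ) ⊆ Finset.range (order Δ + 1) := fun _ hm =>
  Finset.mem_coe.2 <| Finset.mem_range_succ_iff.2 <|
    not_lt.1 fun h => hm (Q.component_eq_zero h)

lemma finite_support_component (Δ : Diff X E F) : (Function.support (Q.component Δ)).Finite :=
  (Finset.finite_toSet _).subset (Q.support_component_subset Δ)

lemma finsum_component (Δ : Diff X E F) : ∑ᶠ m, Q.component Δ m = Δ := by
  rw [finsum_eq_sum_of_support_subset _ (Q.support_component_subset Δ),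
    sum_range_order_component]

lemma total_injective : Function.Injective Q.total := by
  refine toModule_injective_of_filtration
    (fun n => (DiffPred X E F n).submoduleOf (Diff X E F)) _
    (fun i _ h σ => diffOrd_le_diffPred h (Q.q i σ).2) fun n σ hσ => ?_
  rw [← Q.symbol_q n σ]
  exact (symbol_eq_zero_iff X E F n (Q.q n σ)).2 hσ

lemma total_totalSymbol (Δ : Diff X E F) : Q.total (Q.totalSymbol Δ) = Δ := by
  have hvanish : ∀ m ∉ Finset.range (order Δ + 1), Q.totalSymbol Δ m = 0 := fun m hm => by
    rw [totalSymbol_apply]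
    exact Q.part_eq_zero Δ m (by simpa using hm)
  calc Q.total (Q.totalSymbol Δ) = ∑ m ∈ Finset.range (order Δ + 1),
          Submodule.inclusion (diffOrd_le X E F m) (Q.q m (Q.totalSymbol Δ m)) :=
        toModule_eq_sum _ _ hvanish
    _ = ∑ m ∈ Finset.range (order Δ + 1), Q.component Δ m := by
        simp only [totalSymbol_apply, component]
    _ = Δ := Q.sum_range_order_component Δ

lemma totalSymbol_total (σ : SymbTotal X E F) : Q.totalSymbol (Q.total σ) = σ :=
  Q.total_injective (Q.total_totalSymbol _)

/-- A full quantization as an isomorphism `Symb_d^•(E, F) ≃ Diff_d(E, F)` over `Hom_A(F, F)`,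
with inverse the total symbol. -/
def totalEquiv : SymbTotal X E F ≃ₗ[Module.End A F] Diff X E F where
  __ := Q.total
  invFun := Q.totalSymbol
  left_inv := Q.totalSymbol_total
  right_inv := Q.total_totalSymbol

end Quantization

namespace NaturalQuantization

attribute [local instance] canonicalModule canonicalModule_tower

variable (Q : NaturalQuantization X E)

lemma total_app_apply (F : ModuleCat.{u} A) (σ : SymbTotal X E F) :
    (Q.total.app F).hom σ = (Q.onModule F).total σ := rfl

/-- The component at `F` of a natural full quantization as an isomorphism
`Symb_d^•(E, F) ≃ Diff_d(E, F)` over `k`. -/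
def totalEquiv (F : ModuleCat.{u} A) : SymbTotal X E F ≃ₗ[k] Diff X E F where
  __ := (Q.total.app F).hom
  invFun := (Q.onModule F).totalSymbol
  left_inv σ := (congrArg (Q.onModule F).totalSymbol (Q.total_app_apply F σ)).trans
    ((Q.onModule F).totalSymbol_total σ)
  right_inv Δ := (Q.total_app_apply F _).trans ((Q.onModule F).total_totalSymbol Δ)

/-- A natural full quantization as a natural isomorphism `Symb_d^•(E, -) ≅ Diff_d(E, -)`. -/
def totalIso : symbTotalFunctor X E ≅ diffFunctor X E :=
  NatIso.ofComponents (fun F => (Q.totalEquiv F).toModuleIso) fun f => Q.total.naturality f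

end NaturalQuantization

end NCJet

end

theorem proposition5p24 {k : Type w} [CommRing k] {A : Type u} [Ring A] [Algebra k A]
    (X : NCJet.ExteriorCalculus k A)
    (E : Type u) [AddCommGroup E] [Module k E] [Module A E] [IsScalarTower k A E] :
    (∀ (F : Type u) [AddCommGroup F] [Module k F] [Module A F] [IsScalarTower k A F]
        (Q : NCJet.Quantization X E F),
      (∃ Φ : NCJet.Diff X E F ≃ₗ[Module.End A F] NCJet.SymbTotal X E F,
        (∀ Δ, Φ Δ = Q.totalSymbol Δ) ∧ ∀ σ, Φ.symm σ = Q.total σ) ∧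
      ∀ Δ : NCJet.Diff X E F, (Function.support (Q.component Δ)).Finite ∧
        Δ = ∑ᶠ m, Q.component Δ m) ∧
    (∀ Q : NCJet.NaturalQuantization X E,
      ∃ Φ : NCJet.diffFunctor X E ≅ NCJet.symbTotalFunctor X E,
        Φ.inv = Q.total ∧
        ∀ (F : ModuleCat.{u} A) (Δ : (NCJet.diffFunctor X E).obj F),
          (Φ.hom.app F).hom Δ = Q.totalSymbol F Δ) := by
  refine ⟨fun F _ _ _ _ Q => ⟨?_, fun Δ => ⟨?_, ?_⟩⟩, fun Q => ?_⟩
  · exact ⟨Q.totalEquiv.symm, fun _ => rfl, fun _ => rfl⟩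
  · exact Q.finite_support_component Δ
  · exact (Q.finsum_component Δ).symm
  · exact ⟨Q.totalIso.symm, rfl, fun _ _ => rfl⟩
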